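/- Let $k$ be a field and let $A$ be a (left and right) noetherian Hopf algebra over $k$ with coproduct $\Delta(a)=\sum a_1\otimes a_2$, counit $\epsilon$ and bijective antipode $S$. Let $k$ also denote the trivial $A$-module $A/\ker\epsilon$. Suppose that $A$ is Artin–Schelter Gorenstein of dimension $d$, that is: $\operatorname{injdim}({}_AA)=d<\infty$, $\dim_k\operatorname{Ext}^d_A({}_Ak,{}_AA)=1$ and $\operatorname{Ext}^i_A({}_Ak,{}_AA)=0$ for all $i\neq d$, and the same three conditions hold for right modules. Let $\int^l=\operatorname{Ext}^d_A({}_Ak,{}_AA)$ be the left homological integral of $A$, a right $A$-module through right multiplication on $A$. As $\dim_k\int^l=1$, the algebra $A$ acts on it through an algebra homomorphism $\pi_0: A\to A/\mathrm{r.ann}(\int^l)= k$, i.e. $e\cdot a=\pi_0(a)\,e$ for $e\in\int^l$ and $a\in A$. Let $\xi$ and $\phi$ be the left and right winding automorphisms of $A$ given by $\pi_0$: $$\xi(a)=\sum \pi_0(a_1)\,a_2,\qquad \phi(a)=\sum a_1\,\pi_0(a_2)\qquad(a\in A).$$ Then there is an inner automorphism $\gamma$ of $A$ (conjugation $a\mapsto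 waw^{-1}$ by a unit $w$ of $A$) such that $$S^4=\gamma\circ\phi\circ\xi^{-1}.$$ -/

import Mathlib

open CategoryTheory
open scoped TensorProduct

universe u v

noncomputable section

namespace HopfAS

section Augmented

variable {k : Type u} [Field k] {A : Type v} [Ring A] [Algebra k A]

/-- The trivial left `A`-module `A / ker ε` of an algebra `A` with augmentation `ε`. -/
abbrev trivialModule (ε : A →ₐ[k] k) : ModuleCat.{v} A :=
  ModuleCat.of A (A ⧸ RingHom.ker ε)

/-- The left regular `A`-module. -/
abbrev regularModule (A : Type v) [Ring A] : ModuleCat.{v} A :=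
  ModuleCat.of A A

/-- `Ext^i_A(k, A)`, computed in the category of left `A`-modules. -/
abbrev ExtTrivial (ε : A →ₐ[k] k) (i : ℕ) : Type v :=
  Abelian.Ext.{v} (trivialModule ε) (regularModule A) i

/-- Right multiplication `x ↦ x * a`, an endomorphism of the left regular module. -/
def rightMul (a : A) : regularModule A ⟶ regularModule A :=
  ModuleCat.ofHom (LinearMap.toSpanSingleton A A a)

/-- The right action of `a : A` on `Ext^i_A(k, A)`, induced by right multiplication on `A`. -/
def extAct (ε : A →ₐ[k] k) (i : ℕ) (e : ExtTrivial ε i) (a : A) : ExtTrivial ε i :=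
  e.comp (Abelian.Ext.mk₀ (rightMul a)) (add_zero i)

/-- The augmentation `ε`, regarded as an augmentation of the opposite algebra. -/
def opAugmentation (ε : A →ₐ[k] k) : Aᵐᵒᵖ →ₐ[k] k :=
  ε.fromOpposite fun _ _ => mul_comm _ _

/-- The left module half of the Artin-Schelter Gorenstein condition in dimension `d`. -/
structure IsLeftASGorenstein (ε : A →ₐ[k] k) (d : ℕ) : Prop where
  injdim : injectiveDimension (regularModule A) = d
  finrank_ext : Module.finrank k (ExtTrivial ε d) = 1
  ext_eq_zero : ∀ i : ℕ, i ≠ d → Subsingleton (ExtTrivial ε i)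

/-- The augmented algebra `(A, ε)` is Artin-Schelter Gorenstein of injective dimension `d`.
Right `A`-modules are left modules over the opposite algebra. -/
structure IsASGorenstein (ε : A →ₐ[k] k) (d : ℕ) : Prop where
  left : IsLeftASGorenstein ε d
  right : IsLeftASGorenstein (opAugmentation ε) d

theorem extAct_one (ε : A →ₐ[k] k) (i : ℕ) (e : ExtTrivial ε i) : extAct ε i e 1 = e := by
  have h : rightMul (1 : A) = 𝟙 (regularModule A) := by
    ext
    simp [rightMul]
  simp [extAct, h]

theorem extAct_mul (ε : A →ₐ[k] k) (i : ℕ) (e : ExtTrivial ε i) (a b : A) :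
    extAct ε i e (a * b) = extAct ε i (extAct ε i e a) b := by
  have h : rightMul (a * b) = rightMul a ≫ rightMul b := by
    ext
    simp [rightMul]
  simp [extAct, h]

theorem extAct_add (ε : A →ₐ[k] k) (i : ℕ) (e : ExtTrivial ε i) (a b : A) :
    extAct ε i e (a + b) = extAct ε i e a + extAct ε i e b := by
  have h : rightMul (a + b) = rightMul a + rightMul b := by
    ext
    simp [rightMul]
  simp [extAct, h, Abelian.Ext.mk₀_add, Abelian.Ext.comp_add]

theorem extAct_algebraMap (ε : A →ₐ[k] k) (i : ℕ) (e : ExtTrivial ε i) (r : k) :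
    extAct ε i e (algebraMap k A r) = r • e := by
  refine Eq.trans ?_ (Abelian.Ext.smul_eq_comp_mk₀ e r).symm
  refine congrArg (fun f => e.comp (Abelian.Ext.mk₀ f) (add_zero i)) ?_
  refine ModuleCat.hom_ext (LinearMap.ext fun x => ?_)
  exact (Algebra.commutes r (x : A)).symm

theorem extAct_smul (ε : A →ₐ[k] k) (i : ℕ) (e : ExtTrivial ε i) (r : k) (a : A) :
    extAct ε i (r • e) a = r • extAct ε i e a := by
  simp [extAct]

/-- If `Ext^d_A(k, A)` is one-dimensional, `A` acts on it from the right through a unique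
character. -/
theorem existsUnique_character (ε : A →ₐ[k] k) (d : ℕ)
    (h : Module.finrank k (ExtTrivial ε d) = 1) :
    ∃! π : A →ₐ[k] k, ∀ (a : A) (e : ExtTrivial ε d), extAct ε d e a = π a • e := by
  obtain ⟨e₀, he₀, hs⟩ := finrank_eq_one_iff'.mp h
  choose c hc using fun a : A => hs (extAct ε d e₀ a)
  have inj : ∀ {r s : k}, r • e₀ = s • e₀ → r = s := fun hrs =>
    smul_left_injective k he₀ hrs
  have hmul : ∀ a b, c (a * b) = c a * c b := fun a b => inj (by
    rw [hc, extAct_mul, ← hc a, extAct_smul, ← hc b, smul_smul])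
  have hadd : ∀ a b, c (a + b) = c a + c b := fun a b => inj (by
    rw [hc, extAct_add, ← hc a, ← hc b, add_smul])
  have halg : ∀ r, c (algebraMap k A r) = r := fun r => inj (by
    rw [hc, extAct_algebraMap])
  refine ⟨{ toFun := c
            map_one' := by simpa using halg 1
            map_mul' := hmul
            map_zero' := by simpa using halg 0
            map_add' := hadd
            commutes' := halg }, ?_, ?_⟩
  · intro a e
    obtain ⟨r, rfl⟩ := hs e
    change _ = c a • r • e₀
    rw [extAct_smul, ← hc a, smul_comm]
  · intro π hπ
    ext a
    exact inj ((hπ a e₀).symm.trans (hc a).symm)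

/-- The character `π₀ : A → A / r.ann(∫) = k` by which `A` acts from the right on the left
homological integral `∫ = Ext^d_A(k, A)`. -/
def integralCharacter {ε : A →ₐ[k] k} {d : ℕ} (h : IsASGorenstein ε d) : A →ₐ[k] k :=
  (existsUnique_character ε d h.left.finrank_ext).choose

theorem extAct_eq_smul {ε : A →ₐ[k] k} {d : ℕ} (h : IsASGorenstein ε d)
    (a : A) (e : ExtTrivial ε d) : extAct ε d e a = integralCharacter h a • e :=
  (existsUnique_character ε d h.left.finrank_ext).choose_spec.1 a e

/-- The kernel of the integral character is the right annihilator of the integral. -/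
theorem integralCharacter_eq_zero_iff {ε : A →ₐ[k] k} {d : ℕ} (h : IsASGorenstein ε d)
    (a : A) : integralCharacter h a = 0 ↔ ∀ e : ExtTrivial ε d, extAct ε d e a = 0 := by
  obtain ⟨e₀, he₀, -⟩ := finrank_eq_one_iff'.mp h.left.finrank_ext
  simp only [extAct_eq_smul h]
  refine ⟨fun h0 e => by rw [h0, zero_smul], fun h0 => ?_⟩
  exact (smul_eq_zero.mp (h0 e₀)).resolve_right he₀

end Augmented

section Inner

variable {k : Type u} [Field k] {A : Type v} [Ring A] [Algebra k A]

/-- An algebra automorphism is inner if it is conjugation by a unit. -/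
def IsInner (γ : A ≃ₐ[k] A) : Prop :=
  ∃ w : Aˣ, ∀ a : A, γ a = w * a * (↑w⁻¹ : A)

end Inner

section Winding

variable {k : Type u} [Field k] {A : Type v} [Ring A] [HopfAlgebra k A]

/-- `a ↦ ∑ π(a₁) a₂`. -/
def leftWindingHom (π : A →ₐ[k] k) : A →ₐ[k] A :=
  (Algebra.TensorProduct.lid k A).toAlgHom.comp
    ((Algebra.TensorProduct.map π (AlgHom.id k A)).comp (Bialgebra.comulAlgHom k A))

/-- `a ↦ ∑ a₁ π(a₂)`. -/
def rightWindingHom (π : A →ₐ[k] k) : A →ₐ[k] A :=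
  (Algebra.TensorProduct.rid k k A).toAlgHom.comp
    ((Algebra.TensorProduct.map (AlgHom.id k A) π).comp (Bialgebra.comulAlgHom k A))

/-- The convolution inverse `π ∘ S` of a character `π`. -/
def characterInv (π : A →ₐ[k] k) : A →ₐ[k] k :=
  AlgHom.ofLinearMap (π.toLinearMap ∘ₗ HopfAlgebra.antipode k)
    (by simp [HopfAlgebra.antipode_one])
    (fun a b => by simp [HopfAlgebra.antipode_mul_antidistrib, mul_comm])

theorem leftWindingHom_apply (π : A →ₐ[k] k) {ι : Type*} {a : A} (r : Coalgebra.Repr k a ι) :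
    leftWindingHom π a = ∑ i ∈ r.index, π (r.left i) • r.right i := by
  simp [leftWindingHom, ← r.eq, map_sum]

theorem rightWindingHom_apply (π : A →ₐ[k] k) {ι : Type*} {a : A} (r : Coalgebra.Repr k a ι) :
    rightWindingHom π a = ∑ i ∈ r.index, π (r.right i) • r.left i := by
  simp [rightWindingHom, ← r.eq, map_sum]

theorem leftWindingHom_leftWindingHom (π ρ : A →ₐ[k] k)
    (h : ∀ a : A, ∑ i ∈ (Coalgebra.Repr.arbitrary k a).index,
      ρ ((Coalgebra.Repr.arbitrary k a).left i) * π ((Coalgebra.Repr.arbitrary k a).right i) =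
        Coalgebra.counit (R := k) a) (a : A) :
    leftWindingHom π (leftWindingHom ρ a) = a := by
  have r := Coalgebra.Repr.arbitrary k a
  have key := congrArg
    ((TensorProduct.lid k A).toLinearMap ∘ₗ TensorProduct.map ρ.toLinearMap
      ((TensorProduct.lid k A).toLinearMap ∘ₗ TensorProduct.map π.toLinearMap LinearMap.id))
    (Coalgebra.sum_tmul_tmul_eq r (fun i => Coalgebra.Repr.arbitrary k (r.left i))
      (fun i => Coalgebra.Repr.arbitrary k (r.right i)))
  simp only [map_sum, LinearMap.comp_apply, TensorProduct.map_tmul, LinearEquiv.coe_coe,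
    TensorProduct.lid_tmul, AlgHom.toLinearMap_apply, LinearMap.id_apply, smul_smul] at key
  simp only [← Finset.sum_smul, h, Coalgebra.sum_counit_smul] at key
  rw [leftWindingHom_apply ρ r, map_sum]
  conv_rhs => rw [key]
  refine Finset.sum_congr rfl fun i _ => ?_
  rw [map_smul, leftWindingHom_apply π (Coalgebra.Repr.arbitrary k (r.right i)),
    Finset.smul_sum]
  simp only [smul_smul]

theorem rightWindingHom_rightWindingHom (π ρ : A →ₐ[k] k)
    (h : ∀ a : A, ∑ i ∈ (Coalgebra.Repr.arbitrary k a).index,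
      π ((Coalgebra.Repr.arbitrary k a).left i) * ρ ((Coalgebra.Repr.arbitrary k a).right i) =
        Coalgebra.counit (R := k) a) (a : A) :
    rightWindingHom π (rightWindingHom ρ a) = a := by
  have r := Coalgebra.Repr.arbitrary k a
  have key := congrArg
    ((TensorProduct.rid k A).toLinearMap ∘ₗ TensorProduct.map LinearMap.id
      ((TensorProduct.lid k k).toLinearMap ∘ₗ TensorProduct.map π.toLinearMap ρ.toLinearMap))
    (Coalgebra.sum_tmul_tmul_eq r (fun i => Coalgebra.Repr.arbitrary k (r.left i))
      (fun i => Coalgebra.Repr.arbitrary k (r.right i)))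
  simp only [map_sum, LinearMap.comp_apply, TensorProduct.map_tmul, LinearEquiv.coe_coe,
    TensorProduct.lid_tmul, TensorProduct.rid_tmul, AlgHom.toLinearMap_apply,
    LinearMap.id_apply, smul_eq_mul] at key
  simp only [← Finset.sum_smul, h] at key
  have hc : ∑ i ∈ r.index, Coalgebra.counit (R := k) (r.right i) • r.left i = a := by
    have := congrArg (TensorProduct.rid k A) (Coalgebra.sum_tmul_counit_eq r)
    simpa only [map_sum, TensorProduct.rid_tmul, one_smul] using this
  rw [hc] at key
  rw [rightWindingHom_apply ρ r, map_sum]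
  conv_rhs => rw [← key]
  refine Finset.sum_congr rfl fun i _ => ?_
  rw [map_smul, rightWindingHom_apply π (Coalgebra.Repr.arbitrary k (r.left i)),
    Finset.smul_sum]
  simp only [smul_smul, mul_comm]

theorem characterInv_apply (π : A →ₐ[k] k) (a : A) :
    characterInv π a = π (HopfAlgebra.antipode k a) := rfl

theorem characterInv_mul (π : A →ₐ[k] k) {ι : Type*} {a : A} (r : Coalgebra.Repr k a ι) :
    ∑ i ∈ r.index, characterInv π (r.left i) * π (r.right i) = Coalgebra.counit (R := k) a := by
  simpa [map_sum, characterInv_apply] using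
    congrArg π (HopfAlgebra.sum_antipode_mul_eq_algebraMap_counit r)

theorem mul_characterInv (π : A →ₐ[k] k) {ι : Type*} {a : A} (r : Coalgebra.Repr k a ι) :
    ∑ i ∈ r.index, π (r.left i) * characterInv π (r.right i) = Coalgebra.counit (R := k) a := by
  simpa [map_sum, characterInv_apply] using
    congrArg π (HopfAlgebra.sum_mul_antipode_eq_algebraMap_counit r)

/-- The left winding automorphism `a ↦ ∑ π(a₁) a₂` of a character `π`. -/
def leftWinding (π : A →ₐ[k] k) : A ≃ₐ[k] A :=
  AlgEquiv.ofAlgHom (leftWindingHom π) (leftWindingHom (characterInv π))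
    (AlgHom.ext fun a =>
      leftWindingHom_leftWindingHom _ _ (fun _ => characterInv_mul π _) a)
    (AlgHom.ext fun a =>
      leftWindingHom_leftWindingHom _ _ (fun _ => mul_characterInv π _) a)

/-- The right winding automorphism `a ↦ ∑ a₁ π(a₂)` of a character `π`. -/
def rightWinding (π : A →ₐ[k] k) : A ≃ₐ[k] A :=
  AlgEquiv.ofAlgHom (rightWindingHom π) (rightWindingHom (characterInv π))
    (AlgHom.ext fun a =>
      rightWindingHom_rightWindingHom _ _ (fun _ => mul_characterInv π _) a)
    (AlgHom.ext fun a =>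
      rightWindingHom_rightWindingHom _ _ (fun _ => characterInv_mul π _) a)

end Winding

end HopfAS

end

/-! Write Aᵉ for `Env k A`. The proof computes E = Ext^d(A, Aᵉ) over Aᵉ, with the right Aᵉ-action
coming from right multiplication on Aᵉ, in two ways.

The functor X ↦ X ⊗ A from left modules to bimodules is exact, is left adjoint to restriction along
a ↦ ∑ a₁ ⊗ S(a₂), and sends k to the bimodule A. So E should be Ext^d_A(k, Aᵉ) for the adjoint
action on Aᵉ. This module is free: `untwist` identifies it with A ⊗ A, where A acts on the first
factor. Since A is noetherian, E ≅ Ext^d_A(k, A) ⊗ A ≅ A. Under this identification b ⊗ c acts by v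
↦ c v S²(ξ(b)): the S² comes from the inverse of `untwist`, and ξ from the character π₀ on the
integral. This is `exists_ext_regularBimodule_parametrization`. The identification is given by an
explicit map `extParam`, shown injective with the unit of the adjunction and surjective by dimension
shifting.

The coopposite Hopf algebra has the same algebra and counit, hence the same E and π₀, but its
antipode is S⁻¹ and its left winding is φ. It therefore gives the action v ↦ c v S⁻²(φ(b)) on the
same E. Two such descriptions differ by a unit w with S⁻²(φ(b)) w = w S²(ξ(b)), by
`exists_unit_of_parametrizations`. Applying S² gives the formula for S⁴. -/

noncomputable section

namespace HopfAS

open MulOpposite Coalgebra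

/-! ### The enveloping algebra is free over A for the adjoint action -/

section Enveloping

variable (k : Type u) [Field k] (A : Type v) [Ring A]

/-- The enveloping algebra; its left modules are the `A`-bimodules. -/
abbrev Env [Algebra k A] : Type v := A ⊗[k] Aᵐᵒᵖ

variable [HopfAlgebra k A]

/-- The antipode as an algebra homomorphism to the opposite algebra. -/
def antipodeOp : A →ₐ[k] Aᵐᵒᵖ :=
  AlgHom.ofLinearMap ((opLinearEquiv k).toLinearMap ∘ₗ HopfAlgebra.antipode k)
    (by simp [HopfAlgebra.antipode_one])
    (fun a b => by simp [HopfAlgebra.antipode_mul_antidistrib])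

@[simp]
theorem antipodeOp_apply (a : A) : antipodeOp k A a = op (HopfAlgebra.antipode k a) := rfl

/-- `a ↦ ∑ a₁ ⊗ S(a₂)`; restriction along it turns a bimodule into a left module through
the adjoint action. -/
def adjointHom : A →ₐ[k] Env k A :=
  (Algebra.TensorProduct.map (AlgHom.id k A) (antipodeOp k A)).comp (Bialgebra.comulAlgHom k A)

variable {k A}

theorem adjointHom_apply {ι : Type*} {a : A} (r : Repr k a ι) :
    adjointHom k A a = ∑ i ∈ r.index, r.left i ⊗ₜ op (HopfAlgebra.antipode k (r.right i)) := by
  simp [adjointHom, ← r.eq, map_sum]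

/-- Coassociativity regroups the last two legs of ∑ a₁ ⊗ a₂ ⊗ a₃ as a coproduct, `h` turns it into a
counit, and the counit axiom removes it. The antipode identities below are the cases needed, with
`h` built from multiplication and S. -/
theorem sum_tmul_collapse (h : A ⊗[k] A →ₗ[k] A)
    (hh : ∀ a : A, h (comul a) = algebraMap k A (counit a))
    {ι : Type*} {κ : ι → Type*} {a : A} (r : Repr k a ι) (s : ∀ i, Repr k (r.left i) (κ i)) :
    ∑ i ∈ r.index, ∑ j ∈ (s i).index, (s i).left j ⊗ₜ[k] h ((s i).right j ⊗ₜ r.right i) =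
      a ⊗ₜ 1 := by
  have h1 := congrArg (LinearMap.lTensor A h)
    (sum_tmul_tmul_eq r s (fun i => Repr.arbitrary k (r.right i)))
  simp only [map_sum, LinearMap.lTensor_tmul] at h1
  rw [h1]
  have h2 : ∀ i, ∑ j ∈ (Repr.arbitrary k (r.right i)).index,
      r.left i ⊗ₜ[k] h ((Repr.arbitrary k (r.right i)).left j ⊗ₜ
        (Repr.arbitrary k (r.right i)).right j) =
      r.left i ⊗ₜ (algebraMap k A (counit (r.right i))) := fun i => by
    rw [← TensorProduct.tmul_sum, ← map_sum, (Repr.arbitrary k (r.right i)).eq, hh]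
  simp only [h2]
  have h3 := congrArg (LinearMap.lTensor A (Algebra.linearMap k A)) (sum_tmul_counit_eq r)
  simpa only [map_sum, LinearMap.lTensor_tmul, Algebra.linearMap_apply, map_one] using h3

theorem sum_tmul_mul_antipode {ι : Type*} {κ : ι → Type*} {a : A} (r : Repr k a ι)
    (s : ∀ i, Repr k (r.left i) (κ i)) :
    ∑ i ∈ r.index, ∑ j ∈ (s i).index,
      (s i).left j ⊗ₜ[k] ((s i).right j * HopfAlgebra.antipode k (r.right i)) = a ⊗ₜ 1 := by
  simpa using sum_tmul_collapse (LinearMap.mul' k A ∘ₗ (HopfAlgebra.antipode k).lTensor A)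
    (fun a => by simp) r s

theorem sum_tmul_antipode_mul {ι : Type*} {κ : ι → Type*} {a : A} (r : Repr k a ι)
    (s : ∀ i, Repr k (r.left i) (κ i)) :
    ∑ i ∈ r.index, ∑ j ∈ (s i).index,
      (s i).left j ⊗ₜ[k] (HopfAlgebra.antipode k ((s i).right j) * r.right i) = a ⊗ₜ 1 := by
  simpa using sum_tmul_collapse (LinearMap.mul' k A ∘ₗ (HopfAlgebra.antipode k).rTensor A)
    (fun a => by simp) r s

theorem antipode_algebraMap (c : k) :
    HopfAlgebra.antipode k (algebraMap k A c) = algebraMap k A c := by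
  rw [Algebra.algebraMap_eq_smul_one, map_smul, HopfAlgebra.antipode_one]

/-- S reverses products, so S(a₃) S²(a₂) = S(S(a₂) a₃), which collapses. This identity and the next
make `twist` and `untwist` mutually inverse. -/
theorem sum_tmul_antipode_mul_antipode_sq {ι : Type*} {κ : ι → Type*} {a : A} (r : Repr k a ι)
    (s : ∀ i, Repr k (r.left i) (κ i)) :
    ∑ i ∈ r.index, ∑ j ∈ (s i).index, (s i).left j ⊗ₜ[k]
      (HopfAlgebra.antipode k (r.right i) *
        HopfAlgebra.antipode k (HopfAlgebra.antipode k ((s i).right j))) = a ⊗ₜ 1 := by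
  simpa [HopfAlgebra.antipode_mul_antidistrib] using
    sum_tmul_collapse (HopfAlgebra.antipode k ∘ₗ
      LinearMap.mul' k A ∘ₗ (HopfAlgebra.antipode k).rTensor A)
    (fun a => by simp [antipode_algebraMap]) r s

theorem sum_tmul_antipode_sq_mul_antipode {ι : Type*} {κ : ι → Type*} {a : A} (r : Repr k a ι)
    (s : ∀ i, Repr k (r.left i) (κ i)) :
    ∑ i ∈ r.index, ∑ j ∈ (s i).index, (s i).left j ⊗ₜ[k]
      (HopfAlgebra.antipode k (HopfAlgebra.antipode k (r.right i)) *
        HopfAlgebra.antipode k ((s i).right j)) = a ⊗ₜ 1 := by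
  simpa [HopfAlgebra.antipode_mul_antidistrib] using
    sum_tmul_collapse (HopfAlgebra.antipode k ∘ₗ
      LinearMap.mul' k A ∘ₗ (HopfAlgebra.antipode k).lTensor A)
    (fun a => by simp [antipode_algebraMap]) r s

/-- The isomorphism `x ⊗ v ↦ ∑ x₁ ⊗ v S(x₂)` untwisting the adjoint action on `Env k A`. -/
def untwist : A ⊗[k] A →ₗ[k] Env k A :=
  LinearMap.mul' k (Env k A) ∘ₗ TensorProduct.map (adjointHom k A).toLinearMap
    (Algebra.TensorProduct.includeRight.toLinearMap ∘ₗ (opLinearEquiv k).toLinearMap)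

theorem untwist_tmul (x v : A) :
    untwist (x ⊗ₜ[k] v) = adjointHom k A x * (1 ⊗ₜ op v) := by
  simp [untwist]

/-- Together with bijectivity of `untwist`, this makes the adjoint module Aᵉ free over A on the
second factor. -/
theorem untwist_smul (a : A) (z : A ⊗[k] A) :
    untwist (a • z) = adjointHom k A a * untwist z := by
  induction z with
  | zero => simp
  | add x y hx hy => simp [hx, hy, mul_add]
  | tmul x v => simp [untwist_tmul, TensorProduct.smul_tmul', mul_assoc]

/-- The inverse `x ⊗ y ↦ ∑ x₁ ⊗ y S²(x₂)` of `untwist`. -/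
def twist : Env k A →ₗ[k] A ⊗[k] A :=
  TensorProduct.lift (LinearMap.mk₂ k
    (fun x y => TensorProduct.map LinearMap.id
      (LinearMap.mulLeft k (unop y) ∘ₗ HopfAlgebra.antipode k ∘ₗ HopfAlgebra.antipode k)
        (comul x))
    (fun x x' y => by simp) (fun c x y => by simp)
    (fun x y y' => by
      rw [← LinearMap.add_apply, ← TensorProduct.map_add_right, ← LinearMap.add_comp]
      congr; ext; simp [add_mul])
    (fun c x y => by
      rw [← LinearMap.smul_apply, ← TensorProduct.map_smul_right, ← LinearMap.smul_comp]
      congr; ext; simp))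

theorem twist_tmul {ι : Type*} {x : A} (r : Repr k x ι) (y : Aᵐᵒᵖ) :
    twist (x ⊗ₜ[k] y) = ∑ i ∈ r.index, r.left i ⊗ₜ
      (unop y * HopfAlgebra.antipode k (HopfAlgebra.antipode k (r.right i))) := by
  simp [twist, ← r.eq]

theorem twist_untwist (z : A ⊗[k] A) : twist (untwist z) = z := by
  induction z with
  | zero => simp
  | add x y hx hy => simp [hx, hy]
  | tmul x v =>
    have r := Repr.arbitrary k x
    have h := congrArg (LinearMap.lTensor A (LinearMap.mulLeft k v))
      (sum_tmul_antipode_mul_antipode_sq r fun i => Repr.arbitrary k (r.left i))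
    simp only [map_sum, LinearMap.lTensor_tmul, LinearMap.mulLeft_apply, mul_one] at h
    rw [untwist_tmul, adjointHom_apply r, Finset.sum_mul, map_sum, ← h]
    refine Finset.sum_congr rfl fun i _ => ?_
    rw [Algebra.TensorProduct.tmul_mul_tmul, mul_one, twist_tmul (Repr.arbitrary k (r.left i))]
    simp [mul_assoc]

theorem untwist_twist (z : Env k A) : untwist (twist z) = z := by
  induction z using TensorProduct.induction_on with
  | zero => simp
  | add x y hx hy => simp [hx, hy]
  | tmul x y =>
    have r := Repr.arbitrary k x
    have h := congrArg (LinearMap.lTensor A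
      ((opLinearEquiv k).toLinearMap ∘ₗ LinearMap.mulLeft k (unop y)))
      (sum_tmul_antipode_sq_mul_antipode r fun i => Repr.arbitrary k (r.left i))
    simp only [map_sum, LinearMap.lTensor_tmul, LinearMap.comp_apply, LinearMap.mulLeft_apply,
      mul_one, LinearEquiv.coe_coe, coe_opLinearEquiv, op_unop] at h
    rw [twist_tmul r, map_sum]
    conv_rhs => rw [← h]
    refine Finset.sum_congr rfl fun i _ => ?_
    rw [untwist_tmul, adjointHom_apply (Repr.arbitrary k (r.left i)), Finset.sum_mul]
    simp [mul_assoc]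

end Enveloping

/-! ### The bimodule induced by a left module -/

section Induced

variable (k : Type u) [Field k] (A : Type v) [Ring A] [HopfAlgebra k A]

/-- The underlying space `X ⊗ A` of the bimodule induced by a left module `X`. -/
def Induced (X : Type v) [AddCommGroup X] [Module k X] : Type v := X ⊗[k] A

variable (X : Type v) [AddCommGroup X] [Module k X]

instance : AddCommGroup (Induced k A X) := inferInstanceAs (AddCommGroup (X ⊗[k] A))

instance : Module k (Induced k A X) := inferInstanceAs (Module k (X ⊗[k] A))

/-- The right action of `A` on the second factor of `X ⊗ A`. -/
def rightFactorAction : Aᵐᵒᵖ →ₐ[k] Module.End k (X ⊗[k] A) :=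
  (Module.endTensorEndAlgHom (R := k) (S := k) (A := k) (M := X) (N := A)).comp
    (Algebra.TensorProduct.includeRight.comp (Algebra.lsmul k k A : Aᵐᵒᵖ →ₐ[k] _))

theorem rightFactorAction_tmul (c : Aᵐᵒᵖ) (x : X) (y : A) :
    rightFactorAction k A X c (x ⊗ₜ y) = x ⊗ₜ (y * unop c) := by
  simp only [rightFactorAction, AlgHom.comp_apply, Algebra.TensorProduct.includeRight_apply]
  rfl

variable [Module A X] [IsScalarTower k A X]

/-- The action of `A` on `X ⊗ A` through the coproduct. -/
def diagonalAction : A →ₐ[k] Module.End k (X ⊗[k] A) :=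
  (Module.endTensorEndAlgHom (R := k) (S := k) (A := k) (M := X) (N := A)).comp
    ((Algebra.TensorProduct.map (Algebra.lsmul k k X) (Algebra.lmul k A)).comp
      (Bialgebra.comulAlgHom k A))

theorem diagonalAction_tmul {ι : Type*} {b : A} (r : Repr k b ι) (x : X) (y : A) :
    diagonalAction k A X b (x ⊗ₜ y) = ∑ i ∈ r.index, (r.left i • x) ⊗ₜ (r.right i * y) := by
  simp only [diagonalAction, AlgHom.comp_apply, Bialgebra.comulAlgHom_apply, ← r.eq, map_sum,
    LinearMap.sum_apply, Algebra.TensorProduct.map_tmul]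
  rfl

theorem commute_diagonalAction_rightFactorAction (a : A) (b : Aᵐᵒᵖ) :
    Commute (diagonalAction k A X a) (rightFactorAction k A X b) := by
  have r := Repr.arbitrary k a
  refine TensorProduct.ext' fun x y => ?_
  simp only [Module.End.mul_apply, rightFactorAction_tmul, diagonalAction_tmul k A X r, map_sum,
    mul_assoc]

/-- The bimodule structure `b (x ⊗ y) c = ∑ b₁ x ⊗ b₂ y c`. -/
def inducedAction : Env k A →ₐ[k] Module.End k (X ⊗[k] A) :=
  Algebra.TensorProduct.lift (diagonalAction k A X) (rightFactorAction k A X)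
    (commute_diagonalAction_rightFactorAction k A X)

theorem inducedAction_tmul {ι : Type*} {b : A} (r : Repr k b ι) (c : Aᵐᵒᵖ) (x : X) (y : A) :
    inducedAction k A X (b ⊗ₜ c) (x ⊗ₜ y) =
      ∑ i ∈ r.index, (r.left i • x) ⊗ₜ (r.right i * y * unop c) := by
  rw [inducedAction, Algebra.TensorProduct.lift_tmul, Module.End.mul_apply,
    rightFactorAction_tmul, diagonalAction_tmul k A X r]
  simp only [mul_assoc]

instance : Module (Env k A) (Induced k A X) :=
  Module.compHom (X ⊗[k] A) (inducedAction k A X).toRingHom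

variable {k A X}

/-- The element `x ⊗ y` of the induced bimodule. -/
def Induced.mk (x : X) (y : A) : Induced k A X := x ⊗ₜ[k] y

theorem Induced.smul_mk {ι : Type*} {b : A} (r : Repr k b ι) (c : Aᵐᵒᵖ) (x : X) (y : A) :
    (b ⊗ₜ[k] c : Env k A) • (Induced.mk x y : Induced k A X) =
      ∑ i ∈ r.index, Induced.mk (r.left i • x) (r.right i * y * unop c) :=
  inducedAction_tmul k A X r c x y

end Induced

/-! ### Induction is exact and left adjoint to the adjoint action -/

section Adjunction

open scoped ModuleCat

variable {k : Type u} [Field k] {A : Type v} [Ring A] [HopfAlgebra k A]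

namespace Induced

section

variable {X : Type v} [AddCommGroup X] [Module k X]

theorem induction_on {p : Induced k A X → Prop} (z : Induced k A X) (zero : p 0)
    (mk : ∀ x y, p (mk x y)) (add : ∀ z w, p z → p w → p (z + w)) : p z :=
  TensorProduct.induction_on z zero mk add

theorem mk_add_left (x x' : X) (y : A) :
    (mk (x + x') y : Induced k A X) = mk x y + mk x' y := TensorProduct.add_tmul x x' y

theorem mk_add_right (x : X) (y y' : A) :
    (mk x (y + y') : Induced k A X) = mk x y + mk x y' := TensorProduct.tmul_add x y y'

theorem mk_smul_left (c : k) (x : X) (y : A) :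
    (mk (c • x) y : Induced k A X) = mk x (c • y) := TensorProduct.smul_tmul c x y

end

variable {X : Type v} [AddCommGroup X] [Module k X] [Module A X] [IsScalarTower k A X]

theorem one_tmul_smul_mk (c : Aᵐᵒᵖ) (x : X) (y : A) :
    ((1 : A) ⊗ₜ[k] c : Env k A) • (mk x y : Induced k A X) = mk x (y * unop c) := by
  change inducedAction k A X (1 ⊗ₜ c) (x ⊗ₜ y) = _
  rw [inducedAction, Algebra.TensorProduct.lift_tmul, map_one, one_mul, rightFactorAction_tmul]
  rfl

theorem one_tmul_smul_mk_one (x : X) (y : A) :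
    ((1 : A) ⊗ₜ[k] op y : Env k A) • (mk x 1 : Induced k A X) = mk x y := by
  rw [one_tmul_smul_mk, one_mul, unop_op]

/-- The adjoint action gives ∑ a₁x ⊗ a₂S(a₃), and the last two legs collapse. Thus x ↦ x ⊗ 1 is the
unit of the adjunction. -/
theorem adjointHom_smul_mk_one (a : A) (x : X) :
    adjointHom k A a • (mk x 1 : Induced k A X) = mk (a • x) 1 := by
  have r := Repr.arbitrary k a
  have h := congrArg (TensorProduct.map ((LinearMap.toSpanSingleton A X x).restrictScalars k)
    LinearMap.id) (sum_tmul_mul_antipode r fun i => Repr.arbitrary k (r.left i))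
  simp only [map_sum, TensorProduct.map_tmul, LinearMap.coe_restrictScalars,
    LinearMap.toSpanSingleton_apply, LinearMap.id_apply] at h
  refine Eq.trans ?_ h
  rw [adjointHom_apply r, Finset.sum_smul]
  refine Finset.sum_congr rfl fun i _ => ?_
  rw [smul_mk (Repr.arbitrary k (r.left i))]
  simp only [mul_one, unop_op]
  rfl

/-- The elements x ⊗ 1 generate the induced bimodule under the right action. -/
theorem hom_ext {Y : Type*} [AddCommGroup Y] [Module (Env k A) Y]
    {f g : Induced k A X →ₗ[Env k A] Y} (h : ∀ x, f (mk x 1) = g (mk x 1)) : f = g := by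
  refine LinearMap.ext fun z => ?_
  induction z using induction_on with
  | zero => simp
  | mk x y => rw [← one_tmul_smul_mk_one, map_smul, map_smul, h]
  | add z w hz hw => rw [map_add, map_add, hz, hw]

theorem adjointHom_algebraMap (c : k) :
    adjointHom k A (algebraMap k A c) = algebraMap k (Env k A) c :=
  (adjointHom k A).commutes c

section lift

variable {Y : Type*} [AddCommGroup Y] [Module (Env k A) Y] (g : X →+ Y)
  (hg : ∀ (a : A) (x : X), g (a • x) = adjointHom k A a • g x)

/-- The additive map underlying `Induced.lift`. -/
def liftAux : Induced k A X →+ Y :=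
  TensorProduct.liftAddHom
    (AddMonoidHom.mk' (fun x => AddMonoidHom.mk'
        (fun y : A => ((1 : A) ⊗ₜ[k] op y : Env k A) • g x)
        (fun y y' => by rw [MulOpposite.op_add, TensorProduct.tmul_add, add_smul]))
      (fun x x' => by ext y; simp))
    (fun c x y => by
      change ((1 : A) ⊗ₜ[k] op y : Env k A) • g (c • x) =
        ((1 : A) ⊗ₜ[k] op (c • y) : Env k A) • g x
      rw [← algebraMap_smul A c x, hg, smul_smul, adjointHom_algebraMap,
        MulOpposite.op_smul, TensorProduct.tmul_smul, ← Algebra.commutes, ← Algebra.smul_def])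

theorem liftAux_mk (x : X) (y : A) :
    liftAux g hg (mk x y) = ((1 : A) ⊗ₜ[k] op y : Env k A) • g x := rfl

/-- The bimodule map `X ⊗ A → Y` extending a map `X → Y` that is linear for the adjoint
action. -/
def lift : Induced k A X →ₗ[Env k A] Y where
  __ := liftAux g hg
  map_smul' w z := by
    change liftAux g hg (w • z) = w • liftAux g hg z
    induction z using induction_on with
    | zero => simp
    | add z z' hz hz' => rw [smul_add, map_add, map_add, hz, hz', smul_add]
    | mk x y =>
      induction w using TensorProduct.induction_on with
      | zero =>
        exact (congrArg _ (zero_smul (Env k A) (mk x y : Induced k A X))).trans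
          ((map_zero _).trans (zero_smul (Env k A) (liftAux g hg (mk x y))).symm)
      | add w w' hw hw' => rw [add_smul, map_add, hw, hw', add_smul]
      | tmul b c =>
        have r := Repr.arbitrary k b
        -- Evaluating on b • (x ⊗ y) • c yields ∑ b₁ ⊗ S(b₂) b₃ y c applied to g x. The factor S(b₂)
        -- b₃ collapses, leaving b ⊗ y c.
        have h := congrArg (LinearMap.lTensor A ((opLinearEquiv k).toLinearMap ∘ₗ
            LinearMap.mulRight k (y * unop c)))
          (sum_tmul_antipode_mul r fun i => Repr.arbitrary k (r.left i))
        simp only [map_sum, LinearMap.lTensor_tmul, LinearMap.comp_apply,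
          LinearMap.mulRight_apply, one_mul, LinearEquiv.coe_coe, coe_opLinearEquiv] at h
        rw [smul_mk r, map_sum, liftAux_mk, smul_smul]
        simp only [liftAux_mk, hg, smul_smul]
        rw [← Finset.sum_smul]
        congr 1
        rw [Algebra.TensorProduct.tmul_mul_tmul, mul_one]
        refine Eq.trans ?_ (h.trans (by simp))
        refine Finset.sum_congr rfl fun i _ => ?_
        rw [adjointHom_apply (Repr.arbitrary k (r.left i)), Finset.mul_sum]
        simp [mul_assoc]

theorem lift_mk (x : X) (y : A) :
    lift g hg (mk x y) = ((1 : A) ⊗ₜ[k] op y : Env k A) • g x := rfl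

theorem lift_mk_one (x : X) : lift g hg (mk x 1) = g x := by
  rw [lift_mk, op_one, ← Algebra.TensorProduct.one_def, one_smul]

end lift

/-- Functoriality of the induced bimodule. -/
def map {X' : Type v} [AddCommGroup X'] [Module k X'] [Module A X'] [IsScalarTower k A X']
    (f : X →ₗ[A] X') : Induced k A X →ₗ[Env k A] Induced k A X' :=
  lift ((AddMonoidHom.mk' (fun x => mk x 1) fun x x' => mk_add_left x x' 1).comp
    f.toAddMonoidHom) fun a x => by
      simp [adjointHom_smul_mk_one]

theorem map_mk {X' : Type v} [AddCommGroup X'] [Module k X'] [Module A X'] [IsScalarTower k A X']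
    (f : X →ₗ[A] X') (x : X) (y : A) : map f (mk x y : Induced k A X) = mk (f x) y :=
  one_tmul_smul_mk_one (f x) y

theorem map_eq_rTensor {X' : Type v} [AddCommGroup X'] [Module k X'] [Module A X']
    [IsScalarTower k A X'] (f : X →ₗ[A] X') (z : Induced k A X) :
    map f z = (f.restrictScalars k).rTensor A z := by
  induction z using induction_on with
  | zero => rw [map_zero]; exact (map_zero _).symm
  | mk x y => exact map_mk f x y
  | add z w hz hw => rw [map_add, hz, hw]; exact (map_add _ _ _).symm

end Induced

variable (k A)

/-- The functor `X ↦ X ⊗ A` from left modules to bimodules. -/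
def inducedFunctor : ModuleCat.{v} A ⥤ ModuleCat.{v} (Env k A) where
  obj X := ModuleCat.of (Env k A) (Induced k A X)
  map f := ModuleCat.ofHom (Induced.map f.hom)
  map_id X := ModuleCat.hom_ext (Induced.hom_ext fun x => Induced.map_mk _ x 1)
  map_comp f g := ModuleCat.hom_ext (Induced.hom_ext fun x => by
    simp [Induced.map_mk])

/-- The functor from bimodules to left modules given by the adjoint action. -/
abbrev adjointFunctor : ModuleCat.{v} (Env k A) ⥤ ModuleCat.{v} A :=
  ModuleCat.restrictScalars (adjointHom k A).toRingHom

variable {k A}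

/-- The bimodule map out of the induced bimodule determined by a map of left modules. -/
def inducedDesc {X : ModuleCat.{v} A} {Y : ModuleCat.{v} (Env k A)}
    (g : X ⟶ (adjointFunctor k A).obj Y) : (inducedFunctor k A).obj X ⟶ Y :=
  ModuleCat.ofHom (Induced.lift (Y := Y) g.hom.toAddMonoidHom fun a x => g.hom.map_smul a x)

theorem inducedDesc_mk_one {X : ModuleCat.{v} A} {Y : ModuleCat.{v} (Env k A)}
    (g : X ⟶ (adjointFunctor k A).obj Y) (x : X) :
    (inducedDesc g).hom (Induced.mk x 1) = g.hom x :=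
  Induced.lift_mk_one (Y := Y) g.hom.toAddMonoidHom (fun a x => g.hom.map_smul a x) x

theorem inducedFunctor_map_mk {X X' : ModuleCat.{v} A} (f : X ⟶ X') (x : X) (y : A) :
    ((inducedFunctor k A).map f).hom (Induced.mk x y) = Induced.mk (f.hom x) y :=
  Induced.map_mk f.hom x y

theorem inducedFunctor_hom_ext {X : ModuleCat.{v} A} {Y : ModuleCat.{v} (Env k A)}
    {f g : (inducedFunctor k A).obj X ⟶ Y}
    (h : ∀ x : X, f.hom (Induced.mk x 1) = g.hom (Induced.mk x 1)) : f = g :=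
  ModuleCat.hom_ext (Induced.hom_ext h)

/-- Bimodule maps out of the induced bimodule. -/
def inducedHomEquiv (X : ModuleCat.{v} A) (Y : ModuleCat.{v} (Env k A)) :
    ((inducedFunctor k A).obj X ⟶ Y) ≃ (X ⟶ (adjointFunctor k A).obj Y) where
  toFun f := ModuleCat.ofHom (Y := (adjointFunctor k A).obj Y)
    { toFun := fun x => f.hom (Induced.mk x 1)
      map_add' := fun x x' => (congrArg f.hom (Induced.mk_add_left x x' 1)).trans
        (map_add f.hom (Induced.mk x 1 : Induced k A X) (Induced.mk x' 1 : Induced k A X))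
      map_smul' := fun a x => (congrArg f.hom (Induced.adjointHom_smul_mk_one a x).symm).trans
        (map_smul f.hom (adjointHom k A a) (Induced.mk x 1 : Induced k A X)) }
  invFun g := inducedDesc g
  left_inv _ := inducedFunctor_hom_ext fun x => inducedDesc_mk_one _ x
  right_inv g := ModuleCat.hom_ext (LinearMap.ext fun x => inducedDesc_mk_one g x)

variable (k A)

/-- The induced bimodule functor is left adjoint to the adjoint action functor. -/
def inducedAdjunction : inducedFunctor k A ⊣ adjointFunctor k A :=
  Adjunction.mkOfHomEquiv
    { homEquiv := fun X Y => inducedHomEquiv X Y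
      homEquiv_naturality_left_symm := fun f g => inducedFunctor_hom_ext fun x => by
        refine (inducedDesc_mk_one _ x).trans ?_
        exact ((congrArg (inducedDesc g).hom (inducedFunctor_map_mk f x 1)).trans
          (inducedDesc_mk_one g (f.hom x))).symm
      homEquiv_naturality_right := fun _ _ => rfl }

instance : (inducedFunctor k A).IsLeftAdjoint := (inducedAdjunction k A).isLeftAdjoint

instance : (inducedFunctor k A).Additive where
  map_add {X Y f g} := ModuleCat.hom_ext (Induced.hom_ext fun x => by
    change Induced.map (f + g).hom _ = Induced.map f.hom _ + Induced.map g.hom _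
    rw [Induced.map_mk, Induced.map_mk, Induced.map_mk, ← Induced.mk_add_left]; rfl)

instance : (inducedFunctor k A).PreservesMonomorphisms where
  preserves f hf := by
    rw [ModuleCat.mono_iff_injective] at hf ⊢
    have : Function.Injective ((f.hom.restrictScalars k).rTensor A) :=
      Module.Flat.rTensor_preserves_injective_linearMap _ hf
    intro z w h
    exact this (((Induced.map_eq_rTensor f.hom z).symm.trans h).trans
      (Induced.map_eq_rTensor f.hom w))

instance : Limits.PreservesFiniteColimits (inducedFunctor k A) := inferInstance

/-- A left adjoint is right exact, and flatness of A over the field k preserves monomorphisms, so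
short exact sequences are preserved. -/
instance : Limits.PreservesFiniteLimits (inducedFunctor k A) := by
  refine ((Functor.preservesFiniteLimits_tfae (inducedFunctor k A)).out 0 3).mp fun S hS => ?_
  have := hS.epi_g
  have := hS.mono_f
  have h := ((Functor.preservesFiniteColimits_tfae (inducedFunctor k A)).out 3 0 :)
  exact ⟨(h.mp inferInstance S hS).1, inferInstance⟩

instance : (adjointFunctor k A).IsRightAdjoint := (inducedAdjunction k A).isRightAdjoint

instance : Limits.PreservesFiniteColimits (adjointFunctor k A) := inferInstance

instance : Limits.PreservesFiniteLimits (adjointFunctor k A) := inferInstance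

instance (P : ModuleCat.{v} A) [Projective P] : Projective ((inducedFunctor k A).obj P) :=
  (inducedAdjunction k A).map_projective P inferInstance

end Adjunction

open Abelian

/-! ### Natural transformations and induced maps on Ext -/

section General

universe w w' v₁ v₂ u₁ u₂

variable {C : Type u₁} [Category.{v₁} C] [Abelian C] {D : Type u₂} [Category.{v₂} D] [Abelian D]

theorem exists_shortExact_projective [EnoughProjectives C] (X : C) :
    ∃ (S : ShortComplex C) (_ : S.ShortExact), S.X₃ = X ∧ Projective S.X₂ :=
  ⟨ShortComplex.mk (Limits.kernel.ι (Projective.π X)) (Projective.π X)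
    (Limits.kernel.condition _), ShortComplex.ShortExact.mk
      (ShortComplex.exact_kernel (Projective.π X)), rfl,
    inferInstanceAs (Projective (Projective.over X))⟩

variable [HasExt.{w} C] [HasExt.{w'} D]

/-- A natural transformation from the identity to a composition of exact functors commutes
with the induced maps on `Ext`. -/
theorem ext_unit_naturality [EnoughProjectives C] (F : C ⥤ D) (G : D ⥤ C)
    [F.Additive] [Limits.PreservesFiniteLimits F] [Limits.PreservesFiniteColimits F]
    [G.Additive] [Limits.PreservesFiniteLimits G] [Limits.PreservesFiniteColimits G]
    (τ : 𝟭 C ⟶ F ⋙ G) {Y : C} {n : ℕ} : ∀ {X : C} (e : Ext X Y n),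
    (Ext.mk₀ (τ.app X)).comp ((e.mapExactFunctor F).mapExactFunctor G) (zero_add n) =
      e.comp (Ext.mk₀ (τ.app Y)) (add_zero n) := by
  induction n with
  | zero =>
    intro X e
    obtain ⟨f, rfl⟩ := (Ext.mk₀_bijective X Y).2 e
    rw [Ext.mapExactFunctor_mk₀, Ext.mapExactFunctor_mk₀]
    erw [Ext.mk₀_comp_mk₀, Ext.mk₀_comp_mk₀]
    exact congrArg Ext.mk₀ (τ.naturality f).symm
  | succ n ih =>
    intro X e
    -- Dimension shift: with a projective middle term, every class in degree n + 1 is the extension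
    -- class composed with a class of degree n.
    obtain ⟨S, hS, rfl, hP⟩ := exists_shortExact_projective X
    obtain ⟨e', rfl⟩ := Ext.contravariant_sequence_exact₃ hS Y e
      (Ext.eq_zero_of_projective _) (add_comm 1 n)
    have hSF := hS.map_of_exact F
    have hSG := hSF.map_of_exact G
    -- Naturality of τ makes it a morphism of short exact sequences, so it intertwines their
    -- extension classes.
    let φ : S ⟶ (S.map F).map G :=
      { τ₁ := τ.app S.X₁
        τ₂ := τ.app S.X₂
        τ₃ := τ.app S.X₃
        comm₁₂ := (τ.naturality S.f).symm
        comm₂₃ := (τ.naturality S.g).symm }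
    have h := ShortComplex.ShortExact.extClass_naturality hS hSG φ
    have hcl : (hS.extClass.mapExactFunctor F).mapExactFunctor G = hSG.extClass :=
      (congrArg (Ext.mapExactFunctor G) (Ext.mapExactFunctor_extClass F hS)).trans
        (Ext.mapExactFunctor_extClass G hSF)
    rw [Ext.mapExactFunctor_comp, Ext.mapExactFunctor_comp, hcl,
      Ext.comp_assoc_of_third_deg_zero, ← ih e']
    have h1 := Ext.comp_assoc hS.extClass (Ext.mk₀ (τ.app S.X₁))
      ((e'.mapExactFunctor F).mapExactFunctor G) (add_zero 1) (zero_add n)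
      (by omega : 1 + 0 + n = n + 1)
    have h2 := Ext.comp_assoc (Ext.mk₀ (τ.app S.X₃)) hSG.extClass
      ((e'.mapExactFunctor F).mapExactFunctor G) (zero_add 1) (add_comm 1 n)
      (by omega : 0 + 1 + n = n + 1)
    exact h2.symm.trans ((congrArg (fun z => Ext.comp z
      ((e'.mapExactFunctor F).mapExactFunctor G) (add_comm 1 n)) h).symm.trans h1)

end General

/-! ### Coordinates of maps into A ⊗ V -/

section Contract

variable {k : Type u} [Field k] {A : Type v} [Ring A] [Algebra k A] {V : Type*} [AddCommGroup V]
  [Module k V]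

/-- Contraction of the second factor of `A ⊗ V` against a functional. -/
def contractRight (A : Type v) [Ring A] [Algebra k A] (f : V →ₗ[k] k) : A ⊗[k] V →ₗ[A] A :=
  (TensorProduct.AlgebraTensorModule.rid k A A).toLinearMap ∘ₗ
    TensorProduct.AlgebraTensorModule.map LinearMap.id f

@[simp]
theorem contractRight_tmul (f : V →ₗ[k] k) (x : A) (v : V) :
    contractRight A f (x ⊗ₜ v) = f v • x := by
  simp [contractRight]

/-- Stability under enlarging `T` is included so that the sets for several elements can be merged
into one. -/
theorem exists_finset_sum_contractRight {ι : Type*} (b : Module.Basis ι k V) (z : A ⊗[k] V) :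
    ∃ T : Finset ι, ∀ T', T ⊆ T' → ∑ i ∈ T', contractRight A (b.coord i) z ⊗ₜ[k] b i = z := by
  classical
  induction z with
  | zero => exact ⟨∅, fun T' _ => by simp⟩
  | add z w hz hw =>
    obtain ⟨T, hT⟩ := hz
    obtain ⟨U, hU⟩ := hw
    refine ⟨T ∪ U, fun T' h => ?_⟩
    simp only [map_add, TensorProduct.add_tmul, Finset.sum_add_distrib]
    rw [hT _ (Finset.union_subset_left h), hU _ (Finset.union_subset_right h)]
  | tmul x v =>
    refine ⟨(b.repr v).support, fun T' h => ?_⟩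
    have hv : ∑ i ∈ T', b.repr v i • b i = v := by
      conv_rhs => rw [← b.linearCombination_repr v, Finsupp.linearCombination_apply, Finsupp.sum]
      refine (Finset.sum_subset h fun i _ hi => ?_).symm
      rw [Finsupp.notMem_support_iff.mp hi, zero_smul]
    simp only [contractRight_tmul, TensorProduct.smul_tmul, Module.Basis.coord_apply]
    rw [← TensorProduct.tmul_sum, hv]

/-- Finitely many generators involve finitely many basis vectors. Hence `h` is a finite sum of maps
M → A tensored with vectors, although V may have infinite dimension. -/
theorem exists_finset_sum_contractRight_of_finite {ι : Type*} (b : Module.Basis ι k V)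
    {M : Type*} [AddCommGroup M] [Module A M] [Module.Finite A M] (h : M →ₗ[A] A ⊗[k] V) :
    ∃ T : Finset ι, ∀ m, ∑ i ∈ T, contractRight A (b.coord i) (h m) ⊗ₜ[k] b i = h m := by
  classical
  obtain ⟨s, hs⟩ := Module.Finite.fg_top (R := A) (M := M)
  choose T hT using fun m => exists_finset_sum_contractRight b (h m)
  refine ⟨s.biUnion T, fun m => ?_⟩
  have hm : m ∈ Submodule.span A (s : Set M) := hs ▸ Submodule.mem_top
  induction hm using Submodule.span_induction with
  | mem m hm => exact hT m _ (Finset.subset_biUnion_of_mem T hm)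
  | zero => simp
  | add m m' _ _ hm hm' =>
    simp only [map_add, TensorProduct.add_tmul, Finset.sum_add_distrib, hm, hm']
  | smul a m _ hm =>
    conv_rhs => rw [map_smul, ← hm, Finset.smul_sum]
    simp only [map_smul, TensorProduct.smul_tmul']

end Contract

/-! ### The regular bimodule is induced by the trivial module -/

section RegularBimodule

attribute [local instance] TensorProduct.Algebra.module

/-- The algebra `A` as a bimodule over itself. -/
def regularBimodule (k : Type u) [Field k] (A : Type v) [Ring A] [Algebra k A] :
    ModuleCat.{v} (Env k A) :=
  ModuleCat.of (Env k A) A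

/-- An element of `A`, regarded as an element of the regular bimodule. -/
def regularMk (k : Type u) [Field k] {A : Type v} [Ring A] [Algebra k A] (y : A) :
    regularBimodule k A := y

end RegularBimodule

section TrivialIso

open scoped ModuleCat

attribute [local instance] TensorProduct.Algebra.module

variable (k : Type u) [Field k] (A : Type v) [Ring A] [HopfAlgebra k A]

theorem regularBimodule_smul_def (a : A) (c : Aᵐᵒᵖ) (y : A) :
    (a ⊗ₜ[k] c : Env k A) • regularMk k y = regularMk k (a * (y * unop c)) := rfl

theorem adjointHom_smul_one (a : A) :
    adjointHom k A a • regularMk k (1 : A) = regularMk k (algebraMap k A (counit a)) := by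
  have r := Repr.arbitrary k a
  rw [adjointHom_apply r, Finset.sum_smul,
    ← HopfAlgebra.sum_mul_antipode_eq_algebraMap_counit r]
  refine Finset.sum_congr rfl fun i _ => ?_
  rw [regularBimodule_smul_def, one_mul, unop_op]
  rfl

variable {k A}

/-- The map of left modules `A → Y`, `a ↦ a · y`, for the adjoint action on a bimodule `Y`. -/
def adjointOrbit {Y : ModuleCat.{v} (Env k A)} (y : Y) :
    regularModule A ⟶ (adjointFunctor k A).obj Y :=
  ModuleCat.ofHom (Y := (adjointFunctor k A).obj Y)
    (LinearMap.toSpanSingleton A ((adjointFunctor k A).obj Y) y)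

variable (k A)

/-- The trivial left module of a Hopf algebra. -/
def hopfTrivialModule : ModuleCat.{v} A := trivialModule (Bialgebra.counitAlgHom k A)

/-- The residue class of `a` in the trivial module. -/
def trivialMk (a : A) : hopfTrivialModule k A := Submodule.Quotient.mk a

variable {k A}

theorem trivialMk_surjective : Function.Surjective (trivialMk k A) :=
  Submodule.Quotient.mk_surjective _

theorem smul_trivialMk_one (a : A) :
    a • trivialMk k A 1 = counit (R := k) a • trivialMk k A 1 := by
  refine (Submodule.Quotient.eq (RingHom.ker (Bialgebra.counitAlgHom k A))
    (x := a * 1) (y := algebraMap k A (counit a) * 1)).mpr ?_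
  rw [RingHom.mem_ker]
  simp

theorem trivialMk_eq (a : A) : trivialMk k A a = counit (R := k) a • trivialMk k A 1 := by
  rw [← smul_trivialMk_one]
  exact congrArg (trivialMk k A) (mul_one a).symm

variable (k A)

/-- The map `A / ker ε → A` induced by the counit, linear for the adjoint action. -/
def trivialToRegular : hopfTrivialModule k A ⟶
    (adjointFunctor k A).obj (regularBimodule k A) :=
  ModuleCat.ofHom (Y := (adjointFunctor k A).obj (regularBimodule k A))
    (Submodule.liftQ _ (adjointOrbit (regularMk k (1 : A))).hom
    (fun a ha => by
      refine (adjointHom_smul_one k A a).trans ?_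
      rw [show counit (R := k) a = 0 from ha, map_zero]
      rfl))

theorem trivialToRegular_mk (a : A) :
    (trivialToRegular k A).hom (trivialMk k A a) =
      regularMk k (algebraMap k A (counit a)) :=
  adjointHom_smul_one k A a

/-- The element `1 ⊗ y` of the bimodule induced by the trivial module. -/
def oneMk (y : regularBimodule k A) :
    Induced k A (hopfTrivialModule k A) :=
  Induced.mk (trivialMk k A 1) (show A from y)

/-- On the trivial module b₁ acts by its counit, so ∑ b₁·1 ⊗ b₂yc = 1 ⊗ byc. -/
theorem oneMk_smul (w : Env k A) (y : A) :
    oneMk k A (w • regularMk k y) = w • oneMk k A y := by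
  induction w using TensorProduct.induction_on with
  | zero =>
    have h' := zero_smul (Env k A) (oneMk k A y)
    exact (congrArg (oneMk k A) (zero_smul (Env k A) (regularMk k y))).trans ((TensorProduct.tmul_zero _ _).trans h'.symm)
  | add w w' hw hw' =>
    have h := add_smul w w' (regularMk k y)
    have h' := add_smul w w' (oneMk k A y)
    refine (congrArg (oneMk k A) h).trans (Eq.trans ?_ h'.symm)
    rw [← hw, ← hw']
    exact Induced.mk_add_right _ _ _
  | tmul b c =>
    have r := Repr.arbitrary k b
    refine Eq.trans ?_ (Induced.smul_mk r c _ y).symm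
    rw [regularBimodule_smul_def]
    conv_lhs => rw [← sum_counit_smul r, Finset.sum_mul]
    refine (TensorProduct.tmul_sum _ _ _).trans ?_
    refine Finset.sum_congr rfl fun i _ => ?_
    refine Eq.trans ?_ ((congrArg (fun z => (Induced.mk z _ : Induced k A _))
      (smul_trivialMk_one (r.left i))).trans (Induced.mk_smul_left _ _ _)).symm
    rw [smul_mul_assoc, mul_assoc]
    rfl

/-- The map `y ↦ 1 ⊗ y` from the regular bimodule to the bimodule induced by the trivial
module. -/
def regularToInduced : regularBimodule k A ⟶
    (inducedFunctor k A).obj (hopfTrivialModule k A) :=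
  ModuleCat.ofHom (X := regularBimodule k A)
    (Y := (inducedFunctor k A).obj (hopfTrivialModule k A))
    { toFun := oneMk k A
      map_add' := fun _ _ => Induced.mk_add_right _ _ _
      map_smul' := fun w y => oneMk_smul k A w y }

/-- The bimodule induced by the trivial module is the regular bimodule. -/
def inducedTrivialIso : (inducedFunctor k A).obj (hopfTrivialModule k A) ≅
    regularBimodule k A where
  hom := inducedDesc (trivialToRegular k A)
  inv := regularToInduced k A
  hom_inv_id := inducedFunctor_hom_ext fun x => by
    obtain ⟨x, rfl⟩ := trivialMk_surjective x
    refine (congrArg (regularToInduced k A).hom ((inducedDesc_mk_one _ _).trans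
      (trivialToRegular_mk k A x))).trans ?_
    rw [trivialMk_eq x]
    refine Eq.trans ?_ (Induced.mk_smul_left (k := k) (A := A) _ _ _).symm
    rw [Algebra.algebraMap_eq_smul_one]
    rfl
  inv_hom_id := ModuleCat.hom_ext (LinearMap.ext fun y => by
    refine Eq.trans (congrArg (fun z : regularBimodule k A =>
      ((1 : A) ⊗ₜ[k] op (show A from y) : Env k A) • z) (trivialToRegular_mk k A 1)) ?_
    refine (regularBimodule_smul_def k A _ _ _).trans ?_
    rw [one_mul, unop_op, Bialgebra.counit_one, map_one, one_mul]
    rfl)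

end TrivialIso

/-! ### Classes in Ext(X ⊗ A, Aᵉ) and the right action on them -/

section Param

variable {k : Type u} [Field k] {A : Type v} [Ring A] [HopfAlgebra k A]

theorem inducedHomEquiv_add {X : ModuleCat.{v} A} {Y : ModuleCat.{v} (Env k A)}
    (f g : (inducedFunctor k A).obj X ⟶ Y) :
    inducedHomEquiv X Y (f + g) = inducedHomEquiv X Y f + inducedHomEquiv X Y g := rfl

theorem inducedHomEquiv_sum {X : ModuleCat.{v} A} {Y : ModuleCat.{v} (Env k A)} {ι : Type*}
    (s : Finset ι) (f : ι → ((inducedFunctor k A).obj X ⟶ Y)) :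
    inducedHomEquiv X Y (∑ i ∈ s, f i) = ∑ i ∈ s, inducedHomEquiv X Y (f i) :=
  map_sum (AddMonoidHom.mk' (inducedHomEquiv X Y) inducedHomEquiv_add) f s

theorem inducedHomEquiv_map_comp {X X' : ModuleCat.{v} A} {Y : ModuleCat.{v} (Env k A)}
    (f : X ⟶ X') (g : (inducedFunctor k A).obj X' ⟶ Y) :
    inducedHomEquiv X Y ((inducedFunctor k A).map f ≫ g) = f ≫ inducedHomEquiv X' Y g :=
  (inducedAdjunction k A).homEquiv_naturality_left f g

theorem inducedHomEquiv_desc {X : ModuleCat.{v} A} {Y : ModuleCat.{v} (Env k A)}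
    (g : X ⟶ (adjointFunctor k A).obj Y) : inducedHomEquiv X Y (inducedDesc g) = g :=
  (inducedHomEquiv X Y).right_inv g

variable (k) in
/-- The bimodule map from the bimodule induced by `A` to the free bimodule that corresponds to
the left module map `A → Env k A` with `1 ↦ 1 ⊗ v`. -/
def freeParam (v : A) : (inducedFunctor k A).obj (regularModule A) ⟶ regularModule (Env k A) :=
  inducedDesc (adjointOrbit (Y := regularModule (Env k A)) ((1 : A) ⊗ₜ[k] op v : Env k A))

theorem inducedHomEquiv_freeParam (v : A) :
    inducedHomEquiv _ _ (freeParam k v) =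
      adjointOrbit (Y := regularModule (Env k A)) ((1 : A) ⊗ₜ[k] op v : Env k A) :=
  inducedHomEquiv_desc _

theorem inducedHomEquiv_freeParam_apply (v x : A) :
    (inducedHomEquiv _ _ (freeParam k v)).hom x = untwist (x ⊗ₜ[k] v) := by
  rw [inducedHomEquiv_freeParam, untwist_tmul]
  rfl

theorem inducedHomEquiv_hom_ext {X : ModuleCat.{v} A} {Y : ModuleCat.{v} (Env k A)}
    {f g : (inducedFunctor k A).obj X ⟶ Y}
    (h : ∀ x : X, (inducedHomEquiv X Y f).hom x = (inducedHomEquiv X Y g).hom x) : f = g :=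
  (inducedHomEquiv X Y).injective (ModuleCat.hom_ext (LinearMap.ext h))

theorem map_rightMul_comp_freeParam_apply (a v x : A) :
    (inducedHomEquiv _ _ ((inducedFunctor k A).map (rightMul a) ≫ freeParam k v)).hom x =
      untwist ((x * a) ⊗ₜ[k] v) := by
  rw [inducedHomEquiv_map_comp]
  exact inducedHomEquiv_freeParam_apply v (x * a)

theorem freeParam_add (v w : A) : freeParam k (v + w) = freeParam k v + freeParam k w :=
  inducedHomEquiv_hom_ext fun x => by
    rw [inducedHomEquiv_add]
    refine (inducedHomEquiv_freeParam_apply (v + w) x).trans ?_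
    rw [TensorProduct.tmul_add, map_add, ← inducedHomEquiv_freeParam_apply,
      ← inducedHomEquiv_freeParam_apply]
    rfl

theorem map_rightMul_algebraMap_comp_freeParam (c : k) (v : A) :
    (inducedFunctor k A).map (rightMul (algebraMap k A c)) ≫ freeParam k v =
      freeParam k (c • v) :=
  inducedHomEquiv_hom_ext fun x => by
    refine (map_rightMul_comp_freeParam_apply _ _ _).trans
      (Eq.trans ?_ (inducedHomEquiv_freeParam_apply _ _).symm)
    rw [← Algebra.commutes, ← Algebra.smul_def, TensorProduct.smul_tmul]

/-- Left and right multiplication commute, so untwist(x ⊗ v)(b ⊗ c) is the adjoint action of x on b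
⊗ cv. Rewriting b ⊗ cv as the image under `untwist` of its `twist` produces the factor S²(b₂). -/
theorem freeParam_comp_rightMul {ι : Type*} {b : A} (r : Repr k b ι) (c v : A) :
    freeParam k v ≫ rightMul (b ⊗ₜ[k] op c : Env k A) =
      ∑ i ∈ r.index, (inducedFunctor k A).map (rightMul (r.left i)) ≫ freeParam k
        (c * v * HopfAlgebra.antipode k (HopfAlgebra.antipode k (r.right i))) :=
  inducedHomEquiv_hom_ext fun x => by
    have h1 : (inducedHomEquiv _ _ (freeParam k v ≫ rightMul (b ⊗ₜ[k] op c : Env k A))).hom x =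
        (untwist ((x : A) ⊗ₜ[k] v) * (b ⊗ₜ[k] op c) : Env k A) := by
      rw [← inducedHomEquiv_freeParam_apply]; rfl
    have h2 : ∀ i ∈ r.index, (inducedHomEquiv _ _ ((inducedFunctor k A).map
        (rightMul (r.left i)) ≫ freeParam k (c * v * HopfAlgebra.antipode k
          (HopfAlgebra.antipode k (r.right i))))).hom x = untwist ((x : A) • (r.left i ⊗ₜ[k]
            (c * v * HopfAlgebra.antipode k (HopfAlgebra.antipode k (r.right i))))) :=
      fun i _ => map_rightMul_comp_freeParam_apply _ _ _
    have h3 := twist_tmul r (op (c * v))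
    rw [inducedHomEquiv_sum, h1, ModuleCat.hom_sum, LinearMap.sum_apply,
      Finset.sum_congr rfl h2]
    simp only [unop_op] at h3
    refine Eq.trans ?_ (map_sum untwist _ _)
    rw [← Finset.smul_sum, ← h3, untwist_smul, untwist_twist, untwist_tmul, mul_assoc,
      Algebra.TensorProduct.tmul_mul_tmul, one_mul, ← op_mul]

/-- The classes in `Ext (X ⊗ A, Env k A)` obtained from a class in `Ext (X, A)`. -/
def extParam {X : ModuleCat.{v} A} {n : ℕ} (e : Ext.{v} X (regularModule A) n) :
    A →+ Ext.{v} ((inducedFunctor k A).obj X) (regularModule (Env k A)) n :=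
  AddMonoidHom.mk' (fun v => (e.mapExactFunctor (inducedFunctor k A)).comp
    (Ext.mk₀ (freeParam k v)) (add_zero n))
    (fun v w => by rw [freeParam_add, Ext.mk₀_add, Ext.comp_add])

theorem extParam_apply {X : ModuleCat.{v} A} {n : ℕ} (e : Ext.{v} X (regularModule A) n) (v : A) :
    extParam (k := k) e v = (e.mapExactFunctor (inducedFunctor k A)).comp
      (Ext.mk₀ (freeParam k v)) (add_zero n) := rfl

theorem extParam_comp_rightMul_apply {X : ModuleCat.{v} A} {n : ℕ}
    (e : Ext.{v} X (regularModule A) n) (a v : A) :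
    extParam (k := k) (e.comp (Ext.mk₀ (rightMul a)) (add_zero n)) v =
      (e.mapExactFunctor (inducedFunctor k A)).comp
        (Ext.mk₀ ((inducedFunctor k A).map (rightMul a) ≫ freeParam k v)) (add_zero n) := by
  rw [extParam_apply, Ext.mapExactFunctor_comp, Ext.mapExactFunctor_mk₀,
    Ext.comp_assoc_of_third_deg_zero, Ext.mk₀_comp_mk₀]

theorem extParam_comp_rightMul_algebraMap {X : ModuleCat.{v} A} {n : ℕ}
    (e : Ext.{v} X (regularModule A) n) (c : k) (v : A) :
    extParam (k := k) (e.comp (Ext.mk₀ (rightMul (algebraMap k A c))) (add_zero n)) v =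
      extParam e (c • v) := by
  rw [extParam_comp_rightMul_apply, map_rightMul_algebraMap_comp_freeParam]
  rfl

/-- In ∑ e·b₁ paired with c v S²(b₂), each e·b₁ is π(b₁)e. The scalar moves into the second slot,
where ∑ π(b₁)S²(b₂) is S² of the winding of b. Scalars are expressed through `algebraMap` so that
only composition in Ext is needed. -/
theorem extParam_apply_comp_rightMul {X : ModuleCat.{v} A} {n : ℕ}
    (e : Ext.{v} X (regularModule A) n) {π : A →ₐ[k] k}
    (he : ∀ a, e.comp (Ext.mk₀ (rightMul a)) (add_zero n) =
      e.comp (Ext.mk₀ (rightMul (algebraMap k A (π a)))) (add_zero n)) (b c v : A) :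
    (extParam (k := k) e v).comp (Ext.mk₀ (rightMul (b ⊗ₜ[k] op c : Env k A))) (add_zero n) =
      extParam e (c * v * HopfAlgebra.antipode k (HopfAlgebra.antipode k
        (leftWindingHom π b))) := by
  have r := Repr.arbitrary k b
  rw [extParam_apply, Ext.comp_assoc_of_third_deg_zero, Ext.mk₀_comp_mk₀,
    freeParam_comp_rightMul r, leftWindingHom_apply π r]
  have h := map_sum (Ext.addEquiv₀ (X := (inducedFunctor k A).obj (regularModule A))
    (Y := regularModule (Env k A))).symm (fun i => (inducedFunctor k A).map
      (rightMul (r.left i)) ≫ freeParam k (c * v * HopfAlgebra.antipode k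
        (HopfAlgebra.antipode k (r.right i)))) r.index
  simp only [Ext.addEquiv₀_symm_apply] at h
  rw [h]
  refine (map_sum ((e.mapExactFunctor (inducedFunctor k A)).precomp _ (add_zero n)) _ _).trans ?_
  simp only [map_sum, Finset.mul_sum, map_smul, mul_smul_comm]
  refine Finset.sum_congr rfl fun i _ => ?_
  rw [← extParam_comp_rightMul_algebraMap, ← he, extParam_comp_rightMul_apply]
  rfl

end Param

/-! ### The parametrization of Ext is bijective -/

section Surjective

variable {k : Type u} [Field k] {A : Type v} [Ring A] [HopfAlgebra k A]

/-- `twist` as a map of left modules for the adjoint action. -/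
def twistHom : (adjointFunctor k A).obj (regularModule (Env k A)) ⟶ ModuleCat.of A (A ⊗[k] A) :=
  ModuleCat.ofHom (X := (adjointFunctor k A).obj (regularModule (Env k A))) {
  toFun z := twist (show Env k A from z)
  map_add' z w := map_add twist _ _
  map_smul' a z := by
    change twist (adjointHom k A a * (show Env k A from z)) = a • twist (show Env k A from z)
    conv_lhs => rw [← untwist_twist (show Env k A from z), ← untwist_smul, twist_untwist] }

theorem ext_comp_eq_zero_of_square {C : Type*} [Category* C] [Abelian C] [HasExt.{v} C]
    {X X' Y Y' Z W : C} {n : ℕ} {e : Ext.{v} X Y n} {e' : Ext.{v} X' Y' n} {s : X ⟶ X'}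
    {t : Y ⟶ Y'} (h : (Ext.mk₀ s).comp e' (zero_add n) = e.comp (Ext.mk₀ t) (add_zero n))
    {g : Y' ⟶ Z} (hg : e'.comp (Ext.mk₀ g) (add_zero n) = 0) (q : Z ⟶ W) :
    e.comp (Ext.mk₀ (t ≫ g ≫ q)) (add_zero n) = 0 := by
  rw [← Ext.mk₀_comp_mk₀, ← Ext.mk₀_comp_mk₀, ← Ext.comp_assoc_of_third_deg_zero, ← h,
    ← Ext.comp_assoc_of_third_deg_zero, Ext.comp_assoc_of_third_deg_zero _ e', hg,
    Ext.comp_zero, Ext.zero_comp]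

/-- This is surjectivity of Ext_A(M, A) ⊗ A → Ext(M ⊗ A, Aᵉ). In degree 0 a map M → A ⊗ A is
expanded in a basis of the second factor. Higher degrees follow by dimension shifting along a finite
free cover, since induction is exact and preserves projectives. -/
theorem ext_mem_closure_extParam [IsNoetherianRing A] {n : ℕ} :
    ∀ {M : ModuleCat.{v} A} [Module.Finite A M]
      (e : Ext.{v} ((inducedFunctor k A).obj M) (regularModule (Env k A)) n),
      e ∈ AddSubgroup.closure {z | ∃ (e' : Ext.{v} M (regularModule A) n) (v : A),
        extParam e' v = z} := by
  induction n with
  | zero =>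
    intro M _ e
    obtain ⟨f, rfl⟩ := (Ext.mk₀_bijective _ _).2 e
    classical
    let b := Module.Basis.ofVectorSpace k A
    let h : M →ₗ[A] A ⊗[k] A := (inducedHomEquiv _ _ f ≫ twistHom).hom
    obtain ⟨T, hT⟩ := exists_finset_sum_contractRight_of_finite b h
    let g : Module.Basis.ofVectorSpaceIndex k A → (M ⟶ regularModule A) := fun i =>
      ModuleCat.ofHom (contractRight A (b.coord i) ∘ₗ h)
    have hf : f = ∑ i ∈ T, (inducedFunctor k A).map (g i) ≫ freeParam k (b i) := by
      refine inducedHomEquiv_hom_ext fun m => ?_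
      have h2 : ∀ i ∈ T, (inducedHomEquiv _ _ ((inducedFunctor k A).map (g i) ≫
          freeParam k (b i))).hom m = untwist (contractRight A (b.coord i) (h m) ⊗ₜ[k] b i) :=
        fun i _ => by
          rw [inducedHomEquiv_map_comp]
          exact inducedHomEquiv_freeParam_apply _ _
      rw [inducedHomEquiv_sum, ModuleCat.hom_sum, LinearMap.sum_apply, Finset.sum_congr rfl h2]
      refine Eq.trans ?_ (map_sum untwist _ _)
      rw [hT m]
      exact (untwist_twist _).symm
    rw [hf]
    have h3 := map_sum (Ext.addEquiv₀ (X := (inducedFunctor k A).obj M)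
      (Y := regularModule (Env k A))).symm (fun i => (inducedFunctor k A).map (g i) ≫
        freeParam k (b i)) T
    simp only [Ext.addEquiv₀_symm_apply] at h3
    rw [h3]
    refine sum_mem fun i _ => AddSubgroup.subset_closure ⟨Ext.mk₀ (g i), b i, ?_⟩
    rw [extParam_apply, Ext.mapExactFunctor_mk₀, Ext.mk₀_comp_mk₀]
  | succ n ih =>
    intro M _ e
    obtain ⟨m, p, hp⟩ := Module.Finite.exists_fin' A M
    have hS := LinearMap.shortExact_shortComplexKer hp
    have hSF := hS.map_of_exact (inducedFunctor k A)
    have : Projective (ModuleCat.of A (Fin m → A)) :=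
      (IsProjective.iff_projective _).mp inferInstance
    have : Projective (p.shortComplexKer.map (inducedFunctor k A)).X₂ :=
      inferInstanceAs (Projective ((inducedFunctor k A).obj (ModuleCat.of A (Fin m → A))))
    obtain ⟨e', rfl⟩ := Ext.contravariant_sequence_exact₃ hSF (regularModule (Env k A)) e
      (Ext.eq_zero_of_projective _) (add_comm 1 n)
    -- The noetherian hypothesis keeps the syzygy finitely generated, so the induction hypothesis
    -- applies to it.
    have hK : Module.Finite A (ModuleCat.of A (LinearMap.ker p)) :=
      inferInstanceAs (Module.Finite A (LinearMap.ker p))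
    have he' := ih (M := ModuleCat.of A (LinearMap.ker p)) e'
    let φ : Ext.{v} ((inducedFunctor k A).obj (ModuleCat.of A (LinearMap.ker p)))
        (regularModule (Env k A)) n →+
        Ext.{v} ((inducedFunctor k A).obj M) (regularModule (Env k A)) (n + 1) :=
      hSF.extClass.precomp _ (add_comm 1 n)
    refine (AddSubgroup.closure_le ((AddSubgroup.closure _).comap φ)).mpr ?_ he'
    rintro _ ⟨e'', w, rfl⟩
    refine AddSubgroup.subset_closure ⟨hS.extClass.comp e'' (add_comm 1 n), w, ?_⟩
    rw [extParam_apply, extParam_apply, Ext.mapExactFunctor_comp, Ext.mapExactFunctor_extClass]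
    exact Ext.comp_assoc_of_third_deg_zero _ _ _ _

theorem extParam_surjective [IsNoetherianRing A] {n : ℕ} {M : ModuleCat.{v} A} [Module.Finite A M]
    (e : Ext.{v} M (regularModule A) n)
    (he : ∀ e', ∃ c : k, e.comp (Ext.mk₀ (rightMul (algebraMap k A c))) (add_zero n) = e') :
    Function.Surjective (extParam (k := k) e) := by
  intro z
  have hz := ext_mem_closure_extParam z
  rw [← AddMonoidHom.mem_range]
  refine (AddSubgroup.closure_le _).mpr ?_ hz
  rintro _ ⟨e', v, rfl⟩
  obtain ⟨c, rfl⟩ := he e'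
  exact ⟨c • v, (extParam_comp_rightMul_algebraMap e c v).symm⟩

/-- If the class of v vanishes, pulling it back along the unit of the adjunction and contracting
with a functional f gives f(v)e = 0. So f(v) = 0 for every f, and v = 0. -/
theorem extParam_injective {n : ℕ} {M : ModuleCat.{v} A}
    (e : Ext.{v} M (regularModule A) n)
    (he : ∀ c : k, e.comp (Ext.mk₀ (rightMul (algebraMap k A c))) (add_zero n) = 0 → c = 0) :
    Function.Injective (extParam (k := k) e) := by
  rw [injective_iff_map_eq_zero]
  intro v hv
  refine (Module.forall_dual_apply_eq_zero_iff k v).mp fun f => he _ ?_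
  let η := (inducedAdjunction k A).unit
  let q : (adjointFunctor k A).obj (regularModule (Env k A)) ⟶ regularModule A :=
    twistHom ≫ ModuleCat.ofHom (contractRight A f)
  -- The adjunct of `freeParam k v` is x ↦ untwist(x ⊗ v); twisting back and contracting leaves
  -- f(v)x.
  have h1 : η.app (regularModule A) ≫ (adjointFunctor k A).map (freeParam k v) ≫ q =
      rightMul (algebraMap k A (f v)) := by
    refine ModuleCat.hom_ext (LinearMap.ext fun x => ?_)
    have hx := inducedHomEquiv_freeParam_apply (k := k) v x
    refine (congrArg q.hom hx).trans ?_
    change contractRight A f (twist (untwist ((show A from x) ⊗ₜ v))) =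
      (show A from x) * algebraMap k A (f v)
    rw [twist_untwist, contractRight_tmul, ← Algebra.commutes, Algebra.smul_def]
  have h2 := congrArg (Ext.mapExactFunctor (adjointFunctor k A)) hv
  rw [extParam_apply, Ext.mapExactFunctor_comp, Ext.mapExactFunctor_mk₀,
    Ext.mapExactFunctor_zero] at h2
  have h3 := ext_unit_naturality (inducedFunctor k A) (adjointFunctor k A) η e
  rw [← h1]
  exact ext_comp_eq_zero_of_square h3 h2 q

end Surjective

/-! ### Ext of the regular bimodule as a twisted copy of A -/

section Parametrization

variable {k : Type u} [Field k] {A : Type v} [Ring A] [HopfAlgebra k A]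

instance : Module.Finite A (hopfTrivialModule k A) :=
  inferInstanceAs (Module.Finite A (A ⧸ RingHom.ker (Bialgebra.counitAlgHom k A)))

theorem bijective_mk₀_iso_comp {C : Type*} [Category* C] [Abelian C] [HasExt.{v} C]
    {X X' : C} (i : X ≅ X') (Y : C) (n : ℕ) :
    Function.Bijective (fun e : Ext.{v} X' Y n => (Ext.mk₀ i.hom).comp e (zero_add n)) := by
  refine Function.bijective_iff_has_inverse.mpr
    ⟨fun e => (Ext.mk₀ i.inv).comp e (zero_add n), fun e => ?_, fun e => ?_⟩ <;> simp

/-- If `Ext^d(k, A)` is one-dimensional with character `π`, then `Ext^d` of the regular bimodule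
with values in the free bimodule is `A` with its right action twisted by the square of the
antipode and the left winding automorphism of `π`. -/
theorem exists_ext_regularBimodule_parametrization [IsNoetherianRing A] {d : ℕ} (π : A →ₐ[k] k)
    (hd : Module.finrank k (ExtTrivial (Bialgebra.counitAlgHom k A) d) = 1)
    (hπ : ∀ (a : A) (e : ExtTrivial (Bialgebra.counitAlgHom k A) d),
      extAct (Bialgebra.counitAlgHom k A) d e a = π a • e) :
    ∃ Θ : A → Ext.{v} (regularBimodule k A) (regularModule (Env k A)) d, Function.Bijective Θ ∧
      ∀ b c v : A, (Θ v).comp (Ext.mk₀ (rightMul (b ⊗ₜ[k] op c : Env k A))) (add_zero d) =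
        Θ (c * v * HopfAlgebra.antipode k (HopfAlgebra.antipode k (leftWindingHom π b))) := by
  obtain ⟨e₀, he₀, hs⟩ := finrank_eq_one_iff'.mp hd
  let e : Ext.{v} (hopfTrivialModule k A) (regularModule A) d := e₀
  refine ⟨fun v => (Ext.mk₀ (inducedTrivialIso k A).inv).comp (extParam e v) (zero_add d),
    (bijective_mk₀_iso_comp (inducedTrivialIso k A).symm _ d).comp ⟨?_, ?_⟩, fun b c v => ?_⟩
  · refine extParam_injective e fun c hc => ?_
    have h := (extAct_algebraMap (Bialgebra.counitAlgHom k A) d e₀ c).symm.trans hc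
    exact (smul_eq_zero.mp h).resolve_right he₀
  · refine extParam_surjective e fun e' => ?_
    obtain ⟨c, hc⟩ := hs e'
    exact ⟨c, (extAct_algebraMap (Bialgebra.counitAlgHom k A) d e₀ c).trans hc⟩
  · rw [Ext.comp_assoc_of_third_deg_zero]
    refine congrArg (fun z => (Ext.mk₀ (inducedTrivialIso k A).inv).comp z (zero_add d))
      (extParam_apply_comp_rightMul e (fun a => ?_) b c v)
    exact (hπ a e₀).trans (extAct_algebraMap (Bialgebra.counitAlgHom k A) d e₀ (π a)).symm

end Parametrization

/-! ### The coopposite Hopf algebra -/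

section Coopposite

variable (k : Type u) [Field k] (A : Type v) [Ring A]

section

variable {k A}

theorem comm_comul [Bialgebra k A] {ι : Type*} {a : A} (r : Repr k a ι) :
    TensorProduct.comm k A A (comul a) = ∑ i ∈ r.index, r.right i ⊗ₜ r.left i := by
  simp only [← r.eq, map_sum, TensorProduct.comm_tmul]

end

/-- The coopposite coalgebra. -/
abbrev coopCoalgebra [Bialgebra k A] : Coalgebra k A where
  comul := (TensorProduct.comm k A A).toLinearMap ∘ₗ comul
  counit := counit
  coassoc := by
    ext a
    have r := Repr.arbitrary k a
    have h := congrArg ((TensorProduct.assoc k A A A).toLinearMap ∘ₗ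
      (TensorProduct.comm k A (A ⊗[k] A)).toLinearMap ∘ₗ
        LinearMap.lTensor A (TensorProduct.comm k A A).toLinearMap)
      (sum_tmul_tmul_eq r (fun i => Repr.arbitrary k (r.left i))
        (fun i => Repr.arbitrary k (r.right i)))
    simp only [map_sum, LinearMap.comp_apply, LinearEquiv.coe_coe, LinearMap.lTensor_tmul,
      TensorProduct.comm_tmul, TensorProduct.assoc_tmul] at h
    simp only [LinearMap.comp_apply, LinearEquiv.coe_coe, comm_comul r, map_sum,
      LinearMap.rTensor_tmul, LinearMap.lTensor_tmul, comm_comul (Repr.arbitrary k (r.left _)),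
      comm_comul (Repr.arbitrary k (r.right _)), TensorProduct.tmul_sum, TensorProduct.sum_tmul,
      TensorProduct.assoc_tmul]
    exact h.symm
  rTensor_counit_comp_comul := by
    ext a
    have r := Repr.arbitrary k a
    have h := congrArg (TensorProduct.comm k _ _) (sum_tmul_counit_eq r)
    simp only [map_sum, TensorProduct.comm_tmul] at h
    simp only [LinearMap.comp_apply, LinearEquiv.coe_coe, comm_comul r, map_sum,
      LinearMap.rTensor_tmul]
    exact h
  lTensor_counit_comp_comul := by
    ext a
    have r := Repr.arbitrary k a
    have h := congrArg (TensorProduct.comm k _ _) (sum_counit_tmul_eq r)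
    simp only [map_sum, TensorProduct.comm_tmul] at h
    simp only [LinearMap.comp_apply, LinearEquiv.coe_coe, comm_comul r, map_sum,
      LinearMap.lTensor_tmul]
    exact h

/-- The coopposite bialgebra. -/
abbrev coopBialgebra [Bialgebra k A] : Bialgebra k A :=
  @Bialgebra.mk' k A _ _ _ (coopCoalgebra k A)
    (Bialgebra.counit_one (R := k))
    (fun {a b} => Bialgebra.counit_mul (R := k) a b)
    ((congrArg (TensorProduct.comm k A A) (Bialgebra.comul_one (R := k))).trans
      (map_one (Algebra.TensorProduct.comm k A A)))
    (fun {a b} => (congrArg (TensorProduct.comm k A A) (Bialgebra.comul_mul (R := k) a b)).trans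
      (map_mul (Algebra.TensorProduct.comm k A A) _ _))

variable {k A}

section

variable [HopfAlgebra k A] (hS : Function.Bijective (HopfAlgebra.antipode k (A := A)))

/-- The inverse of a bijective antipode. -/
def antipodeInv : A →ₗ[k] A := (LinearEquiv.ofBijective _ hS).symm.toLinearMap

theorem antipode_antipodeInv (a : A) : HopfAlgebra.antipode k (antipodeInv hS a) = a :=
  (LinearEquiv.ofBijective _ hS).apply_symm_apply a

/-- Applying S, which is injective and reverses products, turns this into the axiom for ∑ S(a₁)a₂.
-/
theorem sum_antipodeInv_mul {ι : Type*} {a : A} (r : Repr k a ι) :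
    ∑ i ∈ r.index, antipodeInv hS (r.right i) * r.left i = algebraMap k A (counit a) := by
  refine hS.1 ?_
  rw [antipode_algebraMap, ← HopfAlgebra.sum_antipode_mul_eq_algebraMap_counit r, map_sum]
  simp only [HopfAlgebra.antipode_mul_antidistrib, antipode_antipodeInv]

theorem sum_mul_antipodeInv {ι : Type*} {a : A} (r : Repr k a ι) :
    ∑ i ∈ r.index, r.right i * antipodeInv hS (r.left i) = algebraMap k A (counit a) := by
  refine hS.1 ?_
  rw [antipode_algebraMap, ← HopfAlgebra.sum_mul_antipode_eq_algebraMap_counit r, map_sum]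
  simp only [HopfAlgebra.antipode_mul_antidistrib, antipode_antipodeInv]

end

/-- The coopposite Hopf algebra, with the inverse of the antipode as antipode. -/
abbrev coopHopfAlgebra [HopfAlgebra k A]
    (hS : Function.Bijective (HopfAlgebra.antipode k (A := A))) : HopfAlgebra k A :=
  { coopBialgebra k A with
    antipode := antipodeInv hS
    mul_antipode_rTensor_comul := by
      ext a
      have r := Repr.arbitrary k a
      change LinearMap.mul' k A ((antipodeInv hS).rTensor A (TensorProduct.comm k A A (comul a))) =
        algebraMap k A (counit a)
      simpa only [comm_comul r, map_sum, LinearMap.rTensor_tmul, LinearMap.mul'_apply] using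
        sum_antipodeInv_mul hS r
    mul_antipode_lTensor_comul := by
      ext a
      have r := Repr.arbitrary k a
      change LinearMap.mul' k A ((antipodeInv hS).lTensor A (TensorProduct.comm k A A (comul a))) =
        algebraMap k A (counit a)
      simpa only [comm_comul r, map_sum, LinearMap.lTensor_tmul, LinearMap.mul'_apply] using
        sum_mul_antipodeInv hS r }

/-- Exchanging the legs of the coproduct exchanges the two windings; this is how φ enters. -/
theorem leftWindingHom_coop [HopfAlgebra k A]
    (hS : Function.Bijective (HopfAlgebra.antipode k (A := A))) (π : A →ₐ[k] k) (b : A) :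
    @leftWindingHom k _ A _ (coopHopfAlgebra hS) π b = rightWindingHom π b := by
  have r := Repr.arbitrary k b
  rw [rightWindingHom_apply π r]
  exact @leftWindingHom_apply k _ A _ (coopHopfAlgebra hS) π _ b
    (@Coalgebra.Repr.mk k A _ _ _ (coopCoalgebra k A).toCoalgebraStruct b _ r.index r.right r.left
      (comm_comul r).symm)

end Coopposite

/-! ### Comparing two parametrizations -/

section Comparison

/-- Taking b = 1, where both twists are trivial, Θ(1) and Θ'(1) are free generators for the action
of c, so Θ'(1) = Θ(w) with w a unit. Acting by b on this element in both descriptions compares σ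
with σ'. -/
theorem exists_unit_of_parametrizations {A : Type*} [Ring A] {E : Type*} {Θ Θ' : A → E}
    (hΘ : Function.Bijective Θ) (hΘ' : Function.Bijective Θ') {σ σ' : A → A} (hσ : σ 1 = 1)
    (hσ' : σ' 1 = 1) (ρ : A → A → E → E) (h : ∀ b c v, ρ b c (Θ v) = Θ (c * v * σ b))
    (h' : ∀ b c v, ρ b c (Θ' v) = Θ' (c * v * σ' b)) :
    ∃ w : Aˣ, ∀ b, σ' b * w = w * σ b := by
  obtain ⟨w, hw⟩ := hΘ.2 (Θ' 1)
  obtain ⟨w', hw'⟩ := hΘ'.2 (Θ 1)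
  have h1 : ∀ c, Θ' c = Θ (c * w) := fun c => by
    have := h' 1 c 1
    rw [← hw, h, hσ, hσ', mul_one, mul_one, mul_one] at this
    exact this.symm
  have h2 : ∀ c, Θ c = Θ' (c * w') := fun c => by
    have := h 1 c 1
    rw [← hw', h', hσ, hσ', mul_one, mul_one, mul_one] at this
    exact this.symm
  refine ⟨⟨w, w', hΘ'.1 ?_, hΘ.1 ?_⟩, fun b => hΘ.1 ?_⟩
  · rw [← h2, hw]
  · rw [← h1, hw']
  · have := h' b 1 1
    rw [← hw, h, one_mul, one_mul, one_mul, h1] at this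
    exact this.symm

/-- Conjugation by a unit. -/
def conjAlgEquiv (k : Type u) [Field k] {A : Type v} [Ring A] [Algebra k A] (w : Aˣ) :
    A ≃ₐ[k] A where
  toFun a := w * a * (↑w⁻¹ : A)
  invFun a := (↑w⁻¹ : A) * a * w
  left_inv a := by simp [mul_assoc]
  right_inv a := by simp [mul_assoc]
  map_mul' a b := by simp [mul_assoc]
  map_add' a b := by simp [mul_add, add_mul]
  commutes' c := by rw [← Algebra.commutes]; simp [mul_assoc]

end Comparison

end HopfAS

end

/-! ### The formula for the fourth power of the antipode -/

theorem corollary4p6 {k : Type u} [Field k] {A : Type v} [Ring A] [HopfAlgebra k A]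
    [IsNoetherianRing A] [IsNoetherianRing Aᵐᵒᵖ]
    (hS : Function.Bijective (HopfAlgebra.antipode k (A := A)))
    (d : ℕ) (hA : HopfAS.IsASGorenstein (Bialgebra.counitAlgHom k A) d) :
    ∃ γ : A ≃ₐ[k] A, HopfAS.IsInner γ ∧
      (⇑(HopfAlgebra.antipode k (A := A)))^[4] =
        γ ∘ HopfAS.rightWinding (HopfAS.integralCharacter hA) ∘
          (HopfAS.leftWinding (HopfAS.integralCharacter hA)).symm := by
  set π := HopfAS.integralCharacter hA
  let S := HopfAlgebra.antipode k (A := A)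
  let T := HopfAS.antipodeInv hS
  have hST : ∀ a, S (T a) = a := HopfAS.antipode_antipodeInv hS
  obtain ⟨Θ, hΘ, h⟩ := HopfAS.exists_ext_regularBimodule_parametrization π
    hA.left.finrank_ext (HopfAS.extAct_eq_smul hA)
  -- Passing to the coopposite changes neither the algebra nor the counit, so the same hypotheses
  -- and π apply, and Θ' has the same target with the same action as Θ.
  obtain ⟨Θ', hΘ', h'⟩ := @HopfAS.exists_ext_regularBimodule_parametrization k _ A _
    (HopfAS.coopHopfAlgebra hS) _ d π hA.left.finrank_ext (HopfAS.extAct_eq_smul hA)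
  have hφ := HopfAS.leftWindingHom_coop hS π
  have hT1 : T 1 = 1 := hS.1 ((hST 1).trans HopfAlgebra.antipode_one.symm)
  obtain ⟨w, hw⟩ := HopfAS.exists_unit_of_parametrizations hΘ hΘ'
    (σ := fun b => S (S (HopfAS.leftWindingHom π b)))
    (σ' := fun b => T (T (HopfAS.rightWindingHom π b)))
    (by simp [S]) (by simp [hT1])
    (fun b c e => e.comp (Abelian.Ext.mk₀ (HopfAS.rightMul (b ⊗ₜ[k] MulOpposite.op c)))
      (add_zero d)) h (fun b c v => by rw [← hφ]; exact h' b c v)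
  have hSS : ∀ a b, S (S (a * b)) = S (S a) * S (S b) := fun a b => by
    simp [S, HopfAlgebra.antipode_mul_antidistrib]
  have h1 : S (S 1) = 1 := by simp [S]
  -- S² is multiplicative, so it carries w to a unit u and turns S⁻²(φ(b)) w = w S²(ξ(b)) into φ(b)
  -- u = u S⁴(ξ(b)). The conjugating unit is therefore u⁻¹.
  let u : Aˣ := ⟨S (S w), S (S (↑w⁻¹ : A)), by rw [← hSS, w.mul_inv, h1],
    by rw [← hSS, w.inv_mul, h1]⟩
  refine ⟨HopfAS.conjAlgEquiv k u⁻¹, ⟨u⁻¹, fun _ => rfl⟩, funext fun a => ?_⟩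
  obtain ⟨b, rfl⟩ := (HopfAS.leftWinding π).surjective a
  have h2 := congrArg (fun z => S (S z)) (hw b)
  simp only [hSS, hST] at h2
  simp only [Function.comp_apply, AlgEquiv.symm_apply_apply]
  change S (S (S (S (HopfAS.leftWindingHom π b)))) =
    (↑u⁻¹ : A) * HopfAS.rightWindingHom π b * u
  rw [mul_assoc, Units.eq_inv_mul_iff_mul_eq]
  exact h2.symm
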